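/- Let $F$ be a finite field or a non-archimedean local field, with its usual topology, of characteristic not $2$ and residual characteristic $p$. Let $\mathcal K=\mathbb Q(\zeta_p)$ if $F$ has positive characteristic and $\mathcal K=\mathbb Q(\zeta_{p^\infty})$ if $F$ has characteristic $0$, and let $\mathcal A=\mathcal O_{\mathcal K}[1/p]$, where $\mathcal O_{\mathcal K}$ is the integral closure of $\mathbb Z$ in $\mathcal K$. Let $\psi:F\to\mathcal A^\times$ be a non-trivial smooth character. Let $(W,\langle\,,\rangle)$ be a finite-dimensional symplectic space over $F$ and let $\mathbb H=W\times F$ be its Heisenberg group, with law $(w,t)(w',t')=(w+w',t+t'+\tfrac12\langle w,w'\rangle)$, on which $\mathrm{Sp}(W)$ acts by $g(w,t)=(gw,t)$. Let $A$ be a closed subgroup of $W$ which is self-dual, i.e. $A=\{w\in W:\psi(\langle w,a\rangle)=1\ \forall a\in A\}$, put $A_{\mathbb H}=A\times F\subseteq\mathbb H$, and let $\psi_A:A_{\mathbb H}\to\mathcal A^\times$ be a smooth character extending $\psi$. For a commutative $\mathcal A$-algebra $R$ with structure morphism $\varphi_R$, let $\psi^R=\varphi_R\circ\psi$, $\psi_A^R=\varphi_R\circ\psi_A$,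 and let $V_A^R=\mathrm{ind}_{A_{\mathbb H}}^{\mathbb H}(\psi_A^R)$ be the smooth compact induction: the locally constant functions $f:\mathbb H\to R$ with $f(ah)=\psi_A^R(a)f(h)$ for $a\in A_{\mathbb H}$, whose support has compact image in $A_{\mathbb H}\backslash\mathbb H$. For $g\in\mathrm{Sp}(W)$, let $\sigma_R(g)\in\mathrm{PGL}_R(V_A^R)=\mathrm{GL}_R(V_A^R)/R^\times$ be the class of the invertible operators $I_{gA,A,\mu,z}\circ I_g$, $$(I_{gA,A,\mu,z}\circ I_g)f(h)=\int_{gA\cap A\backslash A}\psi_A^R((a,0))^{-1}f\big(g^{-1}\cdot((z,0)(a,0)h)\big)\,d\mu(a),$$ where $\mu$ is an invertible $R$-valued Haar measure (the volumes of the compact open subgroups generate the unit ideal of $R$) and $z\in W$ satisfies $\psi_A^R((g^{-1}a,0))\,\psi_A^R((a,0))^{-1}=\psi^R(\langle a,z\rangle)$ for all $a\in gA\cap A$. The metaplectic group $\widetilde{\mathrm{Sp}}{}^R$ over $R$ is the fibre product of $\sigma_R$ and $\mathrm{red}:\mathrm{GL}_R(V_A^R)\to\mathrm{PGL}_R(V_A^R)$,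 i.e. the subgroup of $\mathrm{Sp}(W)\times\mathrm{GL}_R(V_A^R)$ generated by (and, $\sigma_R$ being a group morphism, consisting of) the pairs $(g,M)$ with $\mathrm{red}(M)=\sigma_R(g)$; the Weil representation $\omega_{\psi^R}$ of $\widetilde{\mathrm{Sp}}{}^R$ on $V_A^R$ is the second projection $(g,M)\mapsto M$. Let $\widetilde{\mathrm{Sp}}{}^R$ carry the topology induced from $\mathrm{Sp}(W)\times\mathrm{GL}_R(V_A^R)$, where the sets $\{M: Ms=s'\}$ form a prebasis of the topology of $\mathrm{GL}_R(V_A^R)$. For a closed subgroup $H$ of $\mathrm{Sp}(W)$, let $\widehat H^{\mathcal A}$ be the intersection of the inverse image of $H$ in $\widetilde{\mathrm{Sp}}{}^{\mathcal A}$ with the derived group $[\widetilde{\mathrm{Sp}}{}^{\mathcal A},\widetilde{\mathrm{Sp}}{}^{\mathcal A}]$. For an $\mathcal A$-algebra $\mathcal B$ with structure morphism $\varphi$, let $\mathrm{Rep}'_{\mathcal B}(\widehat H^{\mathcal A})$ be the category of smooth representations of $\widehat H^{\mathcal A}$ over $\mathcal B$ in which $(\mathrm{Id}_W,\epsilon\,\mathrm{Id})$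 acts by $\varphi(\epsilon)$ for every $\epsilon\in\{\pm1\}$ such that this element lies in $\widehat H^{\mathcal A}$. Then for every commutative $\mathcal A$-algebra $\mathcal B$ with structure morphism $\varphi$: (1) there is an isomorphism of $\mathcal B$-modules $e:V_A^{\mathcal A}\otimes_{\mathcal A}\mathcal B\to V_A^{\mathcal B}$ with $e(f\otimes b)=b\,(\varphi\circ f)$; (2) writing $\phi_{\mathcal B}(M)=e\circ(M\otimes_{\mathcal A}\mathcal B)\circ e^{-1}$, the formula $(g,M)\mapsto(g,\phi_{\mathcal B}(M))$ defines a group morphism $\widetilde{\phi_{\mathcal B}}:\widetilde{\mathrm{Sp}}{}^{\mathcal A}\to\widetilde{\mathrm{Sp}}{}^{\mathcal B}$; (3) for every closed subgroup $H$ of $\mathrm{Sp}(W)$, with $\widehat{\phi_{\mathcal B}}$ the restriction of $\widetilde{\phi_{\mathcal B}}$ to $\widehat H^{\mathcal A}$, the representations $(\omega_{\psi^{\mathcal A}}\otimes_{\mathcal A}\mathcal B,\ V_A^{\mathcal A}\otimes_{\mathcal A}\mathcal B)$ and $(\omega_{\psi^{\mathcal B}}\circ\widehat{\phi_{\mathcal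 B}},\ V_A^{\mathcal B})$ of $\widehat H^{\mathcal A}$ both belong to $\mathrm{Rep}'_{\mathcal B}(\widehat H^{\mathcal A})$, and $e$ is an isomorphism between them. So the Weil representations over all $\mathcal A$-algebras $\mathcal B$ come, in this sense, by scalar extension from the single module $(\omega_{\psi^{\mathcal A}},V_A^{\mathcal A})$ over $\mathcal A$. -/

import Mathlib

open scoped TensorProduct

noncomputable section

namespace WeilRep

universe u v w

/-! ### The field `F` and the coefficient ring -/

open scoped ValuativeRel in
/-- `F` is, with its topology, a finite field or a non-archimedean local field,
and `p` is its residual characteristic. -/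
def IsFiniteOrLocalField (F : Type u) [Field F] [TopologicalSpace F] (p : ℕ) : Prop :=
  (Finite F ∧ DiscreteTopology F ∧ CharP F p) ∨
    ∃ _ : ValuativeRel F, IsNonarchimedeanLocalField F ∧ CharP 𝓀[F] p

/-- The orders of the roots of unity generating `𝒦` over `ℚ`: only `p` if `F` has positive
characteristic, and all the powers of `p` if `F` has characteristic zero. -/
def rootOrders (F : Type u) [Field F] (p : ℕ) : Set ℕ :=
  {n | (ringChar F ≠ 0 ∧ n = p) ∨ (ringChar F = 0 ∧ ∃ k : ℕ, n = p ^ k)}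

/-- The ring `𝒜 = 𝒪_𝒦[1/p]`, where `𝒪_𝒦` is the integral closure of `ℤ` in `𝒦`. -/
def CoeffRing (K : Type v) [Field K] (p : ℕ) : Type v :=
  (Algebra.adjoin (integralClosure ℤ K) {(p : K)⁻¹} : Subalgebra (integralClosure ℤ K) K)

instance (K : Type v) [Field K] (p : ℕ) : CommRing (CoeffRing K p) :=
  inferInstanceAs (CommRing (Algebra.adjoin (integralClosure ℤ K) {(p : K)⁻¹} :
    Subalgebra (integralClosure ℤ K) K))

/-! ### Smooth compact induction and Haar measures with values in a ring -/

theorem isClopen_support {X R : Type*} [TopologicalSpace X] [Zero R] {f : X → R}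
    (hf : IsLocallyConstant f) : IsClopen (Function.support f) := by
  have : Function.support f = f ⁻¹' {0}ᶜ := by ext; simp
  rw [this]
  exact ⟨⟨by rw [← Set.preimage_compl]; exact hf _⟩, hf _⟩

/-- `C_c^∞(X, R)`: locally constant functions with compact support. -/
def Cc (R : Type v) [CommRing R] (X : Type u) [TopologicalSpace X] : Submodule R (X → R) where
  carrier := {f | IsLocallyConstant f ∧ IsCompact (Function.support f)}
  zero_mem' := ⟨IsLocallyConstant.const 0, by simp⟩
  add_mem' := by
    rintro f g ⟨hf, hf'⟩ ⟨hg, hg'⟩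
    exact ⟨hf.add hg, (hf'.union hg').of_isClosed_subset
      (isClopen_support (hf.add hg)).isClosed (Function.support_add f g)⟩
  smul_mem' := by
    rintro c f ⟨hf, hf'⟩
    have h : IsLocallyConstant (c • f) := hf.comp (c • ·)
    exact ⟨h, hf'.of_isClosed_subset (isClopen_support h).isClosed
      (Function.support_const_smul_subset c f)⟩

/-- An invertible `R`-valued Haar measure on the commutative group `Q`: a translation-invariant
linear form on `C_c^∞(Q, R)` such that the volumes of the compact open subgroups generate the
unit ideal. (If `R ≠ 0`, such a form is not zero.) -/
structure IsInvertibleHaar {R : Type v} [CommRing R] {Q : Type u} [AddCommGroup Q]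
    [TopologicalSpace Q] (μ : Cc R Q →ₗ[R] R) : Prop where
  invariant : ∀ (q : Q) (Φ Φ' : Cc R Q), (∀ x, Φ'.1 x = Φ.1 (q + x)) → μ Φ' = μ Φ
  invertible : Ideal.span {r : R | ∃ (K : AddSubgroup Q) (Φ : Cc R Q), IsOpen (K : Set Q) ∧
    IsCompact (K : Set Q) ∧ Φ.1 = Set.indicator (K : Set Q) 1 ∧ r = μ Φ} = ⊤

/-- The compact induction `ind_N^G(χ)`: locally constant functions `f : G → R` such that
`f (n g) = χ(n) f(g)` for `n ∈ N`, the support of which has compact image in `N \ G`. -/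
def cInd {R : Type v} [CommRing R] {G : Type u} [Group G] [TopologicalSpace G]
    (N : Subgroup G) (χ : N →* Rˣ) : Submodule R (G → R) where
  carrier := {f | IsLocallyConstant f ∧ (∀ (n : N) (g : G), f (n * g) = χ n * f g) ∧
    IsCompact (Quotient.mk (QuotientGroup.rightRel N) '' Function.support f)}
  zero_mem' := ⟨IsLocallyConstant.const 0, by simp, by simp⟩
  add_mem' := by
    rintro f g ⟨hf, hf', hf''⟩ ⟨hg, hg', hg''⟩
    have e : ∀ (n : N) (x : G), (f + g) (n * x) = χ n * (f + g) x := fun n x ↦ by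
      simp [hf', hg', mul_add]
    refine ⟨hf.add hg, e, (hf''.union hg'').of_isClosed_subset
      (isClosed_image_support (hf.add hg) e) ?_⟩
    rw [← Set.image_union]
    exact Set.image_mono (Function.support_add f g)
  smul_mem' := by
    rintro c f ⟨hf, hf', hf''⟩
    have h : IsLocallyConstant (c • f) := hf.comp (c • ·)
    have e : ∀ (n : N) (x : G), (c • f) (n * x) = χ n * (c • f) x := fun n x ↦ by
      simp [hf', mul_left_comm]
    exact ⟨h, e, hf''.of_isClosed_subset (isClosed_image_support h e)
      (Set.image_mono (Function.support_const_smul_subset c f))⟩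
where
  isClosed_image_support {f : G → R} (hf : IsLocallyConstant f)
      (e : ∀ (n : N) (x : G), f (n * x) = χ n * f x) :
      IsClosed (Quotient.mk (QuotientGroup.rightRel N) '' Function.support f) := by
    rw [← isQuotientMap_quotient_mk'.isClosed_preimage]
    convert (isClopen_support hf).isClosed using 1
    ext x
    constructor
    · rintro ⟨y, hy, hxy⟩
      obtain ⟨n, hn⟩ := (QuotientGroup.rightRel_apply.mp (Quotient.exact hxy) : x * y⁻¹ ∈ N)
        |> fun h ↦ (⟨⟨x * y⁻¹, h⟩, rfl⟩ : ∃ n : N, (n : G) = x * y⁻¹)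
      have : x = n * y := by simp [hn]
      rw [Function.mem_support, this, e]
      simpa using hy
    · intro hx
      exact ⟨x, hx, rfl⟩

/-! ### The Heisenberg group and the symplectic group -/

section Heisenberg

variable {F : Type u} [Field F] {W : Type w} [AddCommGroup W] [Module F W]

/-- The underlying set `W × F` of the Heisenberg group attached to a bilinear form on `W`. -/
@[ext]
structure Heis (form : LinearMap.BilinForm F W) where
  w : W
  t : F

variable {form : LinearMap.BilinForm F W}

/-- `(w, t) (w', t') = (w + w', t + t' + ⟨w, w'⟩ / 2)`. -/
instance : Group (Heis form) where
  mul x y := ⟨x.w + y.w, x.t + y.t + 2⁻¹ * form x.w y.w⟩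
  one := ⟨0, 0⟩
  inv x := ⟨-x.w, -x.t + 2⁻¹ * form x.w x.w⟩
  mul_assoc x y z := by
    change Heis.mk _ _ = Heis.mk _ _
    ext
    · exact add_assoc _ _ _
    · change x.t + y.t + 2⁻¹ * form x.w y.w + z.t + 2⁻¹ * form (x.w + y.w) z.w =
        x.t + (y.t + z.t + 2⁻¹ * form y.w z.w) + 2⁻¹ * form x.w (y.w + z.w)
      simp only [map_add, LinearMap.add_apply]
      ring
  one_mul x := by
    change Heis.mk _ _ = _
    ext
    · exact zero_add _
    · change 0 + x.t + 2⁻¹ * form 0 x.w = x.t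
      simp
  mul_one x := by
    change Heis.mk _ _ = _
    ext
    · exact add_zero _
    · change x.t + 0 + 2⁻¹ * form x.w 0 = x.t
      simp
  inv_mul_cancel x := by
    change Heis.mk _ _ = Heis.mk _ _
    ext
    · exact neg_add_cancel _
    · change -x.t + 2⁻¹ * form x.w x.w + x.t + 2⁻¹ * form (-x.w) x.w = 0
      simp only [map_neg, LinearMap.neg_apply]
      ring

@[simp] theorem Heis.mul_w (x y : Heis form) : (x * y).w = x.w + y.w := rfl
@[simp] theorem Heis.mul_t (x y : Heis form) :
    (x * y).t = x.t + y.t + 2⁻¹ * form x.w y.w := rfl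
@[simp] theorem Heis.one_w : (1 : Heis form).w = 0 := rfl
@[simp] theorem Heis.one_t : (1 : Heis form).t = 0 := rfl
@[simp] theorem Heis.inv_w (x : Heis form) : x⁻¹.w = -x.w := rfl

/-- The product topology. -/
instance [TopologicalSpace F] [TopologicalSpace W] : TopologicalSpace (Heis form) :=
  TopologicalSpace.induced (fun x ↦ (x.w, x.t)) inferInstance

/-- The subgroup `A_H = A × F` of the Heisenberg group. -/
def heisSubgroup (form : LinearMap.BilinForm F W) (A : AddSubgroup W) : Subgroup (Heis form) where
  carrier := {x | x.w ∈ A}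
  one_mem' := A.zero_mem
  mul_mem' := A.add_mem
  inv_mem' := A.neg_mem

/-- The element `(a, 0)` of `A_H`. -/
def heisMk (form : LinearMap.BilinForm F W) {A : AddSubgroup W} {a : W} (ha : a ∈ A) :
    heisSubgroup form A := ⟨⟨a, 0⟩, ha⟩

/-- The symplectic group: the linear automorphisms of `W` preserving the form. -/
def Sp (form : LinearMap.BilinForm F W) : Subgroup (W ≃ₗ[F] W) where
  carrier := {g | ∀ x y, form (g x) (g y) = form x y}
  one_mem' _ _ := rfl
  mul_mem' := fun {g h} hg hh x y ↦ (hg (h x) (h y)).trans (hh x y)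
  inv_mem' := fun {g} hg x y ↦ by
    rw [← hg]
    change form (g (g.symm x)) (g (g.symm y)) = _
    simp

/-- The topology of `Sp(W)` as a subset of the finite-dimensional vector space `End_F(W)`. -/
instance spTopology [TopologicalSpace F] (form : LinearMap.BilinForm F W) :
    TopologicalSpace (Sp form) :=
  TopologicalSpace.induced (fun g ↦ (g.1 : W →ₗ[F] W)) (moduleTopology F (W →ₗ[F] W))

/-- The action of `Sp(W)` on the Heisenberg group: `g (w, t) = (g w, t)`. -/
def spAct (g : Sp form) : Heis form →* Heis form where
  toFun x := ⟨g.1 x.w, x.t⟩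
  map_one' := by ext <;> simp
  map_mul' x y := by
    ext
    · simp
    · simpa using Or.inl (g.2 x.w y.w).symm

/-- The orthogonal of `A`: the `w` such that `ψ` is trivial on `⟨w, A⟩`. -/
def psiOrthogonal {R : Type v} [CommRing R] (form : LinearMap.BilinForm F W) (ψ : AddChar F R)
    (A : AddSubgroup W) : Set W :=
  {x | ∀ a ∈ A, ψ (form x a) = 1}

/-- `gA`. -/
abbrev moved (g : Sp form) (A : AddSubgroup W) : AddSubgroup W :=
  A.map (g.1 : W →ₗ[F] W).toAddMonoidHom

theorem inv_apply_mem (g : Sp form) {A : AddSubgroup W} {x : W} (hx : x ∈ moved g A) :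
    g⁻¹.1 x ∈ A := by
  obtain ⟨a, ha, rfl⟩ := hx
  have : g⁻¹.1 (g.1 a) = a := g.1.symm_apply_apply a
  change g⁻¹.1 (g.1 a) ∈ A
  rwa [this]

/-- The character `χ_{gA}` of `(gA)_H`, defined by `χ_{gA}(g a) = χ_A(a)` for `a ∈ A_H`. -/
def movedChar {R : Type v} [CommRing R] (g : Sp form) {A : AddSubgroup W}
    (χ : heisSubgroup form A →* Rˣ) : heisSubgroup form (moved g A) →* Rˣ :=
  χ.comp (((spAct g⁻¹).comp (heisSubgroup form (moved g A)).subtype).codRestrict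
    (heisSubgroup form A) fun x ↦ inv_apply_mem g x.2)

/-! ### Intertwining integrals and the metaplectic group -/

variable [TopologicalSpace F] [TopologicalSpace W] {R : Type v} [CommRing R]

/-- The model `V_A = ind_{A_H}^H(χ)`, with `H` the Heisenberg group. -/
def Model {A : AddSubgroup W} (χ : heisSubgroup form A →* Rˣ) : Type (max u v w) :=
  cInd (heisSubgroup form A) χ

instance {A : AddSubgroup W} (χ : heisSubgroup form A →* Rˣ) : AddCommGroup (Model χ) :=
  inferInstanceAs (AddCommGroup (cInd (heisSubgroup form A) χ))

instance {A : AddSubgroup W} (χ : heisSubgroup form A →* Rˣ) : Module R (Model χ) :=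
  inferInstanceAs (Module R (cInd (heisSubgroup form A) χ))

instance {A : AddSubgroup W} (χ : heisSubgroup form A →* Rˣ) :
    CoeFun (Model χ) fun _ ↦ Heis form → R :=
  ⟨fun f ↦ Subtype.val (p := (· ∈ cInd (heisSubgroup form A) χ)) f⟩

/-- The quotient `A₁ ∩ A₂ \ A₂`. -/
abbrev InterQuot (A₁ A₂ : AddSubgroup W) := A₂ ⧸ (A₁ ⊓ A₂).addSubgroupOf A₂

/-- The condition `χ₁((a, 0)) χ₂((a, 0))⁻¹ = ψ(⟨a, z⟩)` for all `a ∈ A₁ ∩ A₂`. -/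
def IsCompatiblePoint (ψ : AddChar F R) {A₁ A₂ : AddSubgroup W} (χ₁ : heisSubgroup form A₁ →* Rˣ)
    (χ₂ : heisSubgroup form A₂ →* Rˣ) (z : W) : Prop :=
  ∀ (a : W) (h₁ : a ∈ A₁) (h₂ : a ∈ A₂),
    ((χ₁ (heisMk form h₁) * (χ₂ (heisMk form h₂))⁻¹ : Rˣ) : R) = ψ (form a z)

/-- `f' = I_{A₁, A₂, μ, z} f`, that is
`f'(h) = ∫_{A₁ ∩ A₂ \ A₂} χ₂((a, 0))⁻¹ f((z, 0) (a, 0) h) dμ(a)` for all `h`,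
where the integrand `Φ` is a function in `C_c^∞(A₁ ∩ A₂ \ A₂, R)`. -/
def IsIntertwiningIntegral {A₁ A₂ : AddSubgroup W} (χ₂ : heisSubgroup form A₂ →* Rˣ)
    (μ : Cc R (InterQuot A₁ A₂) →ₗ[R] R) (z : W) (f f' : Heis form → R) : Prop :=
  ∀ h : Heis form, ∃ Φ : Cc R (InterQuot A₁ A₂),
    (∀ a : A₂, Φ.1 (QuotientAddGroup.mk a) =
      (((χ₂ (heisMk form a.2))⁻¹ : Rˣ) : R) * f (⟨z, 0⟩ * ⟨a, 0⟩ * h)) ∧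
    f' h = μ Φ

/-- `M ∈ GL_R(V_A)` is one of the operators `I_{gA, A, μ, z} ∘ I_g`, where `I_g f (h) = f(g⁻¹ h)`,
for an invertible Haar measure `μ` of `gA ∩ A \ A` and a point `z` compatible with
`χ_{gA}` and `χ_A`. -/
def IsWeilOperator (ψ : AddChar F R) {A : AddSubgroup W} (χ : heisSubgroup form A →* Rˣ)
    (g : Sp form) (M : Model χ ≃ₗ[R] Model χ) : Prop :=
  ∃ (μ : Cc R (InterQuot (moved g A) A) →ₗ[R] R) (z : W), IsInvertibleHaar μ ∧
    IsCompatiblePoint ψ (movedChar g χ) χ z ∧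
    ∀ f : Model χ, IsIntertwiningIntegral χ μ z (fun h ↦ f (spAct g⁻¹ h)) (M f)

end Heisenberg

/-- The group `R^×` of scalars in `GL_R(V)`. -/
def scalars (R : Type v) [CommRing R] (V : Type w) [AddCommGroup V] [Module R V] :
    Subgroup (V ≃ₗ[R] V) :=
  (DistribMulAction.toModuleAut R V : Rˣ →* V ≃ₗ[R] V).range

instance (R : Type v) [CommRing R] (V : Type w) [AddCommGroup V] [Module R V] :
    (scalars R V).Normal where
  conj_mem := by
    rintro _ ⟨r, rfl⟩ g
    refine ⟨r, ?_⟩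
    ext x
    change r • x = g ((r : R) • g.symm x)
    rw [map_smul, LinearEquiv.apply_symm_apply]
    rfl

/-- `PGL_R(V) = GL_R(V) / R^×`. -/
abbrev PGL (R : Type v) [CommRing R] (V : Type w) [AddCommGroup V] [Module R V] :=
  (V ≃ₗ[R] V) ⧸ scalars R V

/-- The quotient morphism `GL_R(V) → PGL_R(V)`. -/
abbrev red (R : Type v) [CommRing R] (V : Type w) [AddCommGroup V] [Module R V] :
    (V ≃ₗ[R] V) →* PGL R V := QuotientGroup.mk' (scalars R V)

section Metaplectic

variable {F : Type u} [Field F] {W : Type w} [AddCommGroup W] [Module F W]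
  [TopologicalSpace F] [TopologicalSpace W] {form : LinearMap.BilinForm F W}
  {R : Type v} [CommRing R] {A : AddSubgroup W}

/-- The relation `m = σ_R(g)`, where `σ_R : Sp(W) → PGL_R(V_A)` sends `g` to the common class of
the operators `I_{gA, A, μ, z} ∘ I_g`. -/
def IsSigma (ψ : AddChar F R) (χ : heisSubgroup form A →* Rˣ) (g : Sp form)
    (m : PGL R (Model χ)) : Prop :=
  ∃ M, IsWeilOperator ψ χ g M ∧ red R _ M = m

/-- The metaplectic group over `R`: the fibre product of `σ_R : Sp(W) → PGL_R(V_A)` and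
`red : GL_R(V_A) → PGL_R(V_A)`. As `σ_R` is a group morphism, the set of the pairs `(g, M)`
with `red M = σ_R(g)` is a subgroup of `Sp(W) × GL_R(V_A)`; it is written below as the subgroup
which it generates, so that the definition does not rest on a proof of that fact. -/
def Mp (ψ : AddChar F R) (χ : heisSubgroup form A →* Rˣ) :
    Subgroup (Sp form × (Model χ ≃ₗ[R] Model χ)) :=
  Subgroup.closure {x | IsSigma ψ χ x.1 (red R _ x.2)}

/-- The projection `p_R` of the metaplectic group onto `Sp(W)`. -/
def mpProj (ψ : AddChar F R) (χ : heisSubgroup form A →* Rˣ) : Mp ψ χ →* Sp form :=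
  (MonoidHom.fst _ _).comp (Mp ψ χ).subtype

/-- The Weil representation `ω_ψ` of the metaplectic group on `V_A`: the second projection. -/
def weilRep (ψ : AddChar F R) (χ : heisSubgroup form A →* Rˣ) :
    Representation R (Mp ψ χ) (Model χ) :=
  (LinearEquiv.automorphismGroup.toLinearMapMonoidHom).comp
    ((MonoidHom.snd _ _).comp (Mp ψ χ).subtype)

/-- The topology on `GL_R(V)` with prebasis the sets `{M | M s = s'}`. -/
@[reducible] def glTopology (R : Type v) [CommRing R] (V : Type w) [AddCommGroup V] [Module R V] :
    TopologicalSpace (V ≃ₗ[R] V) :=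
  TopologicalSpace.generateFrom {S | ∃ s s' : V, S = {M | M s = s'}}

/-- The topology on the metaplectic group as a subset of `Sp(W) × GL_R(V_A)`. -/
instance mpTopology (ψ : AddChar F R) (χ : heisSubgroup form A →* Rˣ) :
    TopologicalSpace (Mp ψ χ) :=
  TopologicalSpace.induced Subtype.val
    (@instTopologicalSpaceProd _ _ inferInstance (glTopology R _))

/-- The group `Ĥ`: the intersection of the inverse image of `H ⊆ Sp(W)` and of the derived
group of the metaplectic group. -/
def hatGroup (ψ : AddChar F R) (χ : heisSubgroup form A →* Rˣ) (H : Subgroup (Sp form)) :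
    Subgroup (Mp ψ χ) :=
  H.comap (mpProj ψ χ) ⊓ commutator (Mp ψ χ)

/-- A representation is smooth if the stabilisers of the vectors are open. -/
def IsSmooth {G : Type u} [Group G] [TopologicalSpace G] {V : Type w} [AddCommGroup V] [Module R V]
    (ρ : Representation R G V) : Prop :=
  ∀ v : V, IsOpen {x : G | ρ x v = v}

/-- The objects of `Rep'_B(Ĥ)`, for `Ĥ` over `R` and an `R`-algebra `B`: the smooth representations
of `Ĥ` over `B` such that `(Id_W, ε Id)` acts by the image of `ε` whenever `ε = ± 1` and
`(Id_W, ε Id) ∈ Ĥ`. -/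
structure IsRep' {ψ : AddChar F R} {χ : heisSubgroup form A →* Rˣ} {H : Subgroup (Sp form)}
    {B : Type*} [CommRing B] [Algebra R B] {V : Type*} [AddCommGroup V] [Module B V]
    (ρ : Representation B (hatGroup ψ χ H) V) : Prop where
  smooth : IsSmooth ρ
  sign : ∀ (ε : R) (x : hatGroup ψ χ H), ε = 1 ∨ ε = -1 → x.1.1.1 = 1 →
    (∀ f, x.1.1.2 f = ε • f) → ∀ v, ρ x v = algebraMap R B ε • v

end Metaplectic

/-! ### Scalar extension -/

section ScalarExtension

variable {R : Type v} [CommRing R] (B : Type w) [CommRing B] [Algebra R B]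

/-- `ψ^B = φ ∘ ψ`, where `φ : R → B` is the structure morphism. -/
def extAddChar {F : Type u} [Field F] (ψ : AddChar F R) : AddChar F B :=
  (algebraMap R B).toMonoidHom.compAddChar ψ

/-- `χ^B = φ ∘ χ`. -/
def extChar {N : Type u} [Group N] (χ : N →* Rˣ) : N →* Bˣ :=
  (Units.map (algebraMap R B).toMonoidHom).comp χ

/-- The scalar extension `ρ ⊗_R B` of a representation `ρ` over `R`. -/
def extRep {G : Type u} [Group G] {V : Type*} [AddCommGroup V] [Module R V]
    (ρ : Representation R G V) : Representation B G (B ⊗[R] V) where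
  toFun x := (ρ x).baseChange B
  map_one' := by ext; simp
  map_mul' x y := by ext; simp

/-- For an identification `e : V ⊗_R B ≃ V'`, the group morphism `GL_R(V) → GL_B(V')`
sending `M` to `e ∘ (M ⊗_R B) ∘ e⁻¹`. -/
def glExt {V V' : Type*} [AddCommGroup V] [Module R V] [AddCommGroup V'] [Module B V']
    (e : B ⊗[R] V ≃ₗ[B] V') : (V ≃ₗ[R] V) →* (V' ≃ₗ[B] V') where
  toFun M := e.symm.trans ((M.baseChange R B V V).trans e)
  map_one' := by
    ext x
    change e ((LinearMap.id : V →ₗ[R] V).baseChange B (e.symm x)) = x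
    simp
  map_mul' M N := by
    ext x
    change e (((M : V →ₗ[R] V) ∘ₗ (N : V →ₗ[R] V)).baseChange B (e.symm x)) =
      e ((M : V →ₗ[R] V).baseChange B (e.symm (e ((N : V →ₗ[R] V).baseChange B (e.symm x)))))
    rw [e.symm_apply_apply, LinearMap.baseChange_comp]
    rfl

end ScalarExtension

end WeilRep

end

noncomputable section

open scoped TensorProduct Topology

namespace WeilRep

universe u v w

/-! ### The field `F` and the coefficient ring -/

/-! The point is that functions in `V_A` over `𝒜` can be recovered linearly from finitely many
values, with coefficients again in `V_A`. Since `p ^ k → 0` in `F`, the elements `x ^ p ^ k` of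
`A_H` tend to `1`, so the locally constant `ψA` takes its values in roots of unity of `p`-power
order (`exists_pow_eq_one`). As `p` is a unit of the domain `𝒜`, these roots of unity act freely on
the non-zero vectors of every `𝒜`-module `N` (`eq_zero_of_rootOfUnity_smul_eq`).

Let `f` be an equivariant locally constant function with values in `N`, with compact support modulo
`A_H`. Its non-zero values lie in finitely many orbits of roots of unity. Choose a point `j` above
each orbit and let `s j x = ζ` if `f x = ζ • f j`, and `0` otherwise. By freeness `s j` is well
defined and lies in `V_A` over `𝒜`, and `f x = ∑ s j x • f j` (`exists_sampling`). With `N = B` this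
makes `V_A ⊗ B → V_A^B` surjective; with `N` a finite power of `𝒜` it makes it injective
(`IsScalarExtension`).

The same argument with the trivial group of scalars handles `C_c^∞`, hence invertible Haar measures
extend to `B`. The intertwining integrals then commute with scalar extension, so `φ_B` preserves
Weil operators and scalars, hence the metaplectic groups. Finally `e` intertwines the two
representations because `φ_B` is conjugation by `e`. -/

open scoped ValuativeRel in
theorem tendsto_residueChar_pow_of_local (F : Type*) [Field F] [TopologicalSpace F]
    [ValuativeRel F] [IsNonarchimedeanLocalField F] (p : ℕ) [CharP 𝓀[F] p] :
    Filter.Tendsto (fun k : ℕ ↦ (p : F) ^ k) Filter.atTop (𝓝 0) := by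
  have hp : ValuativeRel.valuation F (p : F) < 1 := by
    have h : ((p : 𝒪[F]) : 𝒪[F]) ∈ 𝓂[F] := by
      rw [← IsLocalRing.residue_eq_zero_iff, map_natCast, CharP.cast_eq_zero]
    have h' := (IsLocalRing.mem_maximalIdeal _).mp h
    rw [mem_nonunits_iff, Valuation.Integers.isUnit_iff_valuation_eq_one
      (Valuation.integer.integers (ValuativeRel.valuation F))] at h'
    refine lt_of_le_of_ne ?_ ?_
    · exact (Valuation.mem_integer_iff _ _).mp (natCast_mem (ValuativeRel.valuation F).integer p)
    · simpa using h'
  -- The valuation has rank at most one, so the powers of an element of valuation `< 1` fall below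
  -- every `γ`.
  have : MulArchimedean (ValuativeRel.ValueGroupWithZero F) :=
    ValuativeRel.isRankLeOne_iff_mulArchimedean.mp inferInstance
  rw [(IsValuativeTopology.hasBasis_nhds_zero' F).tendsto_right_iff]
  intro γ hγ
  obtain ⟨n, hn⟩ := exists_pow_lt₀ hp (Units.mk0 γ hγ)
  filter_upwards [Filter.eventually_ge_atTop n] with k hk
  rw [map_pow]
  exact (pow_le_pow_right_of_le_one' hp.le hk).trans_lt hn

theorem IsFiniteOrLocalField.ne_zero {F : Type*} [Field F] [TopologicalSpace F] {p : ℕ}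
    (hF : IsFiniteOrLocalField F p) : p ≠ 0 := by
  rcases hF with ⟨_, _, _⟩ | ⟨_, _, _⟩
  · exact CharP.char_ne_zero_of_finite F p
  · exact CharP.char_ne_zero_of_finite (IsLocalRing.ResidueField
      (Valuation.integer (ValuativeRel.valuation F))) p

theorem IsFiniteOrLocalField.isTopologicalRing {F : Type*} [Field F] [TopologicalSpace F] {p : ℕ}
    (hF : IsFiniteOrLocalField F p) : IsTopologicalRing F := by
  rcases hF with ⟨_, _, _⟩ | ⟨_, _, _⟩ <;> infer_instance

theorem IsFiniteOrLocalField.tendsto_pow {F : Type*} [Field F] [TopologicalSpace F] {p : ℕ}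
    (hF : IsFiniteOrLocalField F p) :
    Filter.Tendsto (fun k : ℕ ↦ (p : F) ^ k) Filter.atTop (𝓝 0) := by
  rcases hF with ⟨_, _, _⟩ | ⟨_, _, _⟩
  · refine tendsto_const_nhds.congr' ?_
    filter_upwards [Filter.eventually_gt_atTop 0] with k hk
    rw [CharP.cast_eq_zero, zero_pow hk.ne']
  · exact tendsto_residueChar_pow_of_local F p

instance (K : Type v) [Field K] (p : ℕ) : IsDomain (CoeffRing K p) :=
  inferInstanceAs (IsDomain (Algebra.adjoin (integralClosure ℤ K) {(p : K)⁻¹} :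
    Subalgebra (integralClosure ℤ K) K))

theorem CoeffRing.isUnit_natCast (K : Type v) [Field K] [CharZero K] {p : ℕ} (hp : p ≠ 0) :
    IsUnit (p : CoeffRing K p) := by
  let S : Subalgebra (integralClosure ℤ K) K := Algebra.adjoin (integralClosure ℤ K) {(p : K)⁻¹}
  change IsUnit (p : S)
  refine IsUnit.of_mul_eq_one ⟨(p : K)⁻¹, Algebra.subset_adjoin rfl⟩ ?_
  ext
  simp [hp]

/-! ### Sampling of locally constant equivariant functions -/

/-- A root of unity whose order is invertible in the domain `R` fixes no non-zero vector,
unless it is `1`. -/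
theorem eq_zero_of_rootOfUnity_smul_eq {R : Type*} [CommRing R] [IsDomain R] {N : Type*}
    [AddCommGroup N] [Module R N] {n : ℕ} (hn : IsUnit (n : R)) {ζ : Rˣ} (hζ : ζ ^ n = 1)
    (hζ1 : ζ ≠ 1) {x : N} (hx : ζ • x = x) : x = 0 := by
  -- Applied to the fixed vector `x`, this sum acts as `n`, which is invertible.
  have hsum : ∑ i ∈ Finset.range n, (ζ : R) ^ i = 0 := by
    have h := geom_sum_mul (ζ : R) n
    rw [← Units.val_pow_eq_pow_val, hζ, Units.val_one, sub_self] at h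
    refine (mul_eq_zero.mp h).resolve_right fun h' ↦ hζ1 (Units.ext (sub_eq_zero.mp h'))
  have hpow : ∀ i : ℕ, (ζ : R) ^ i • x = x := fun i ↦ by
    induction i with
    | zero => simp
    | succ i ih => rw [pow_succ, mul_smul, ← Units.smul_def, hx, ih]
  have h : (n : R) • x = 0 := by
    rw [← zero_smul R x, ← hsum, Finset.sum_smul]
    simp [hpow, Nat.cast_smul_eq_nsmul]
  exact hn.smul_eq_zero.mp h

/-- A function with values in `N`, equivariant along `π` up to a group `Γ` of scalars acting freely
on `N ∖ {0}`, and whose support has a compact image under the quotient map `π`, is determined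
linearly by its values on a finite set of points, with coefficients that are
`Γ`-equivariant functions of its values. -/
theorem exists_sampling {R : Type*} [CommRing R] {N : Type*} [AddCommGroup N] [Module R N]
    (Γ : Subgroup Rˣ) (hΓ : ∀ ζ ∈ Γ, ∀ n : N, ζ • n = n → ζ = 1 ∨ n = 0)
    {X Y : Type*} [TopologicalSpace X] [TopologicalSpace Y] {π : X → Y}
    (hπ : Topology.IsQuotientMap π) {f : X → N} (hf : IsLocallyConstant f)
    (hequiv : ∀ x y, π x = π y → ∃ ζ ∈ Γ, f x = ζ • f y)
    (hcomp : IsCompact (π '' Function.support f)) :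
    ∃ (J : Finset X) (c : X → N → R), (∀ j, ∀ ζ ∈ Γ, ∀ n, c j (ζ • n) = ζ * c j n) ∧
      (∀ j, c j 0 = 0) ∧ ∀ x, f x = ∑ j ∈ J, c j (f x) • f j := by
  classical
  let r : Setoid N :=
    { r := fun m n ↦ ∃ ζ ∈ Γ, m = ζ • n
      iseqv :=
        { refl := fun n ↦ ⟨1, Γ.one_mem, (one_smul _ n).symm⟩
          symm := by
            rintro m n ⟨ζ, hζ, rfl⟩
            exact ⟨ζ⁻¹, Γ.inv_mem hζ, (inv_smul_smul ζ n).symm⟩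
          trans := by
            rintro l m n ⟨ζ, hζ, rfl⟩ ⟨ξ, hξ, rfl⟩
            exact ⟨ζ * ξ, Γ.mul_mem hζ hξ, (mul_smul ζ ξ n).symm⟩ } }
  let q : X → Quotient r := fun x ↦ Quotient.mk r (f x)
  have hq : IsLocallyConstant q := hf.comp _
  -- The orbit map descends to `Y` and is continuous for the discrete topology on orbits, so the
  -- compact image of the support meets finitely many orbits.
  have hfin : (q '' Function.support f).Finite := by
    let : TopologicalSpace (Quotient r) := ⊥
    have : DiscreteTopology (Quotient r) := ⟨rfl⟩
    have hlift : ∀ x y, π x = π y → q x = q y := fun x y h ↦ Quotient.sound (hequiv x y h)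
    let q' : Y → Quotient r := fun y ↦ q (Function.surjInv hπ.surjective y)
    have hq' : q' ∘ π = q := funext fun x ↦ hlift _ _ (Function.surjInv_eq hπ.surjective (π x))
    have hcont : Continuous q' := hπ.continuous_iff.mpr (hq' ▸ hq.continuous)
    have := (hcomp.image hcont).finite_of_discrete
    rwa [← Set.image_comp, hq'] at this
  obtain ⟨J₀, hJ₀, hinj, himg⟩ :
      ∃ J₀ ⊆ Function.support f, Set.InjOn q J₀ ∧ q '' J₀ = q '' Function.support f := by
    obtain ⟨J₀, h₁, h₂⟩ := Set.SurjOn.exists_bijOn_subset (Set.surjOn_image q (Function.support f))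
    exact ⟨J₀, h₁, h₂.injOn, h₂.image_eq⟩
  have hJfin : J₀.Finite := Set.Finite.of_finite_image (himg ▸ hfin) hinj
  -- The clause `n ≠ 0` gives `c j 0 = 0`, which controls supports later. It also forces `f j ≠ 0`,
  -- so that `ζ` is unique by freeness.
  let c : X → N → R := fun j n ↦
    if h : n ≠ 0 ∧ ∃ ζ ∈ Γ, n = ζ • f j then ((h.2.choose : Rˣ) : R) else 0
  have hc : ∀ j n (ζ : Rˣ), n ≠ 0 → ζ ∈ Γ → n = ζ • f j → c j n = ζ := by
    intro j n ζ hn hζ h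
    have hex : n ≠ 0 ∧ ∃ ζ ∈ Γ, n = ζ • f j := ⟨hn, ζ, hζ, h⟩
    have h1 := hex.2.choose_spec
    set ξ := hex.2.choose with hξ
    have h2 : (ζ⁻¹ * ξ) • f j = f j := by rw [mul_smul, ← h1.2, h, inv_smul_smul]
    have h3 : ζ⁻¹ * ξ = 1 := by
      refine (hΓ _ (Γ.mul_mem (Γ.inv_mem hζ) h1.1) _ h2).resolve_right fun h0 ↦ hn ?_
      rw [h, h0, smul_zero]
    simp only [c, dif_pos hex]
    rw [← hξ, ← inv_mul_eq_one.mp h3]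
  have hc' : ∀ j n, (∀ ζ ∈ Γ, n ≠ ζ • f j) → c j n = 0 := fun j n h ↦
    dif_neg fun h' ↦ h'.2.elim fun ζ hζ ↦ h ζ hζ.1 hζ.2
  have hc0 : ∀ j, c j 0 = 0 := fun j ↦ dif_neg fun h ↦ h.1 rfl
  refine ⟨hJfin.toFinset, c, ?_, hc0, ?_⟩
  · intro j ζ hζ n
    by_cases hn : n = 0
    · simp [hn, hc0]
    have hn' : ζ • n ≠ 0 := by rwa [Ne, smul_eq_zero_iff_eq]
    by_cases hex : ∃ ξ ∈ Γ, n = ξ • f j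
    · obtain ⟨ξ, hξ, h⟩ := hex
      rw [hc j n ξ hn hξ h, hc j (ζ • n) (ζ * ξ) hn' (Γ.mul_mem hζ hξ) (by rw [h, mul_smul]),
        Units.val_mul]
    · push Not at hex
      rw [hc' j n hex, hc' j (ζ • n), mul_zero]
      intro ξ hξ h
      refine hex (ζ⁻¹ * ξ) (Γ.mul_mem (Γ.inv_mem hζ) hξ) ?_
      rw [mul_smul, ← h, inv_smul_smul]
  · intro x
    by_cases hx : f x = 0
    · simp [hx, hc0]
    obtain ⟨j, hj, hjx⟩ : q x ∈ q '' J₀ := himg ▸ ⟨x, hx, rfl⟩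
    -- `J₀` has one point per orbit, so only the `j` in the orbit of `f x` contributes.
    rw [Finset.sum_eq_single_of_mem j (hJfin.mem_toFinset.mpr hj)]
    · obtain ⟨ζ, hζ, h⟩ : ∃ ζ ∈ Γ, f x = ζ • f j := Quotient.exact hjx.symm
      rw [hc j (f x) ζ hx hζ h, h, Units.smul_def]
    · intro k hk hkj
      rw [hc' k, zero_smul]
      intro ζ hζ h
      exact hkj (hinj (hJfin.mem_toFinset.mp hk) hj
        ((Quotient.sound ⟨ζ, hζ, h⟩ : q x = q k).symm.trans hjx.symm))

/-! ### Scalar extension of modules of functions -/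

section Extension

variable {R : Type*} [CommRing R] (B : Type*) [CommRing B] [Algebra R B] {X : Type*}

/-- The `B`-linear map `b ⊗ f ↦ b (φ ∘ f)` on a module of `R`-valued functions. -/
def extFun (V : Submodule R (X → R)) : B ⊗[R] V →ₗ[B] X → B :=
  TensorProduct.AlgebraTensorModule.lift
    ((LinearMap.toSpanSingleton B (V →ₗ[R] X → B)
      (((Algebra.linearMap R B).compLeft X) ∘ₗ V.subtype)))

@[simp]
theorem extFun_tmul (V : Submodule R (X → R)) (b : B) (f : V) (x : X) :
    extFun B V (b ⊗ₜ f) x = b * algebraMap R B (f.1 x) := by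
  simp [extFun]

/-- `V` is a module of functions which are determined by finitely many of their values:
the finite families of elements of `V`, and the elements of `V'`, can be interpolated by `V`. -/
structure IsScalarExtension (V : Submodule R (X → R)) (V' : Submodule B (X → B)) : Prop where
  comp_mem : ∀ f ∈ V, (fun x ↦ algebraMap R B (f x)) ∈ V'
  sampling : ∀ S : Finset V, ∃ (J : Finset X) (s : X → V),
    ∀ f ∈ S, ∀ x, f.1 x = ∑ j ∈ J, (s j).1 x * f.1 j
  sampling' : ∀ f ∈ V', ∃ (J : Finset X) (s : X → V),
    ∀ x, f x = ∑ j ∈ J, algebraMap R B ((s j).1 x) * f j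

variable {B} {V : Submodule R (X → R)} {V' : Submodule B (X → B)}

theorem IsScalarExtension.extFun_mem (h : IsScalarExtension B V V') (t : B ⊗[R] V) :
    extFun B V t ∈ V' := by
  induction t with
  | zero => rw [map_zero]; exact V'.zero_mem
  | add s t hs ht => rw [map_add]; exact V'.add_mem hs ht
  | tmul b f =>
    have : extFun B V (b ⊗ₜ f) = b • fun x ↦ algebraMap R B (f.1 x) := by
      ext x
      simp
    rw [this]
    exact V'.smul_mem b (h.comp_mem f.1 f.2)

/-- No flatness is needed. Sampling all the `f` of `∑ b_f ⊗ f` with the same functions `s j`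
rewrites the tensor as `∑ j, (∑ f, b_f φ(f j)) ⊗ s j`, and the inner sums are the values at `j` of
its image. -/
theorem IsScalarExtension.extFun_injective (h : IsScalarExtension B V V') :
    Function.Injective (extFun B V) := by
  rw [injective_iff_map_eq_zero]
  intro t ht
  obtain ⟨S, rfl⟩ := TensorProduct.exists_finsupp_right t
  obtain ⟨J, s, hs⟩ := h.sampling S.support
  have hf : ∀ f ∈ S.support, f = ∑ j ∈ J, f.1 j • s j := fun f hf ↦ by
    ext x
    rw [hs f hf x]
    simp [mul_comm]
  have hval : ∀ j, ∑ f ∈ S.support, S f * algebraMap R B (f.1 j) = 0 := fun j ↦ by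
    simpa [Finsupp.sum] using congrFun ht j
  calc S.sum (fun f b ↦ b ⊗ₜ[R] f)
      = ∑ f ∈ S.support, ∑ j ∈ J, (S f * algebraMap R B (f.1 j)) ⊗ₜ[R] s j := by
        refine Finset.sum_congr rfl fun f hfS ↦ ?_
        trans S f ⊗ₜ[R] ∑ j ∈ J, f.1 j • s j
        · rw [← hf f hfS]
        rw [TensorProduct.tmul_sum]
        refine Finset.sum_congr rfl fun j _ ↦ ?_
        rw [← TensorProduct.smul_tmul, Algebra.smul_def, mul_comm]
    _ = 0 := by
        rw [Finset.sum_comm]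
        refine Finset.sum_eq_zero fun j _ ↦ ?_
        rw [← TensorProduct.sum_tmul, hval, TensorProduct.zero_tmul]

theorem IsScalarExtension.exists_extFun_eq (h : IsScalarExtension B V V') {f : X → B}
    (hf : f ∈ V') : ∃ t, extFun B V t = f := by
  obtain ⟨J, s, hs⟩ := h.sampling' f hf
  refine ⟨∑ j ∈ J, f j ⊗ₜ s j, ?_⟩
  ext x
  rw [hs x]
  simp [mul_comm]

/-- The isomorphism `V ⊗ B ≃ V'`. -/
def IsScalarExtension.equiv (h : IsScalarExtension B V V') : B ⊗[R] V ≃ₗ[B] V' :=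
  LinearEquiv.ofBijective ((extFun B V).codRestrict V' h.extFun_mem)
    ⟨fun _ _ hst ↦ h.extFun_injective (congrArg Subtype.val hst), fun f ↦
      (h.exists_extFun_eq f.2).imp fun _ ht ↦ Subtype.ext ht⟩

theorem IsScalarExtension.equiv_apply (h : IsScalarExtension B V V') (t : B ⊗[R] V) :
    (h.equiv t).1 = extFun B V t := rfl

theorem IsScalarExtension.equiv_tmul (h : IsScalarExtension B V V') (b : B) (f : V) (x : X) :
    (h.equiv (b ⊗ₜ f)).1 x = b * algebraMap R B (f.1 x) :=
  extFun_tmul B V b f x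

end Extension
/-! ### Scalar extension of `C_c^∞` and of compact inductions -/

section Cc

variable {R : Type*} [CommRing R] (B : Type*) [CommRing B] [Algebra R B]

/-- Allows a finite family of functions to be sampled at once, as a single function with values in a
finite power. -/
theorem isLocallyConstant_pi {X ι M : Type*} [TopologicalSpace X] [Finite ι] {f : X → ι → M}
    (hf : ∀ i, IsLocallyConstant fun x ↦ f x i) : IsLocallyConstant f := by
  let : TopologicalSpace M := ⊥
  have : DiscreteTopology M := ⟨rfl⟩
  exact IsLocallyConstant.iff_continuous f |>.mpr
    (continuous_pi fun i ↦ (IsLocallyConstant.iff_continuous _).mp (hf i))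

theorem isCompact_image_support_pi {X Y ι M : Type*} [TopologicalSpace Y] [Finite ι] [Zero M]
    {π : X → Y} {f : X → ι → M}
    (hf : ∀ i, IsCompact (π '' Function.support fun x ↦ f x i)) :
    IsCompact (π '' Function.support f) := by
  have : Function.support f = ⋃ i, Function.support fun x ↦ f x i := by
    ext x
    simp [funext_iff]
  rw [this, Set.image_iUnion]
  exact isCompact_iUnion hf

/-- The case of trivial scalars and `π = id`: the sampling functions are the indicators of the level
sets of `f`. -/
theorem exists_sampling_Cc {X : Type*} [TopologicalSpace X] {N : Type*} [AddCommGroup N]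
    [Module R N] {f : X → N} (hf : IsLocallyConstant f) (hcomp : IsCompact (Function.support f)) :
    ∃ (J : Finset X) (s : X → Cc R X), ∀ x, f x = ∑ j ∈ J, (s j).1 x • f j := by
  obtain ⟨J, c, -, hc0, h⟩ := exists_sampling (⊥ : Subgroup Rˣ)
    (fun ζ hζ _ _ ↦ Or.inl (Subgroup.mem_bot.mp hζ)) (N := N) (π := id) .id hf
    (fun x y hxy ↦ ⟨1, Subgroup.one_mem _, by rw [one_smul, show x = y from hxy]⟩)
    (by rwa [Set.image_id])
  refine ⟨J, fun j ↦ ⟨c j ∘ f, hf.comp _, ?_⟩, h⟩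
  refine hcomp.of_isClosed_subset (isClopen_support (hf.comp _)).isClosed fun x hx h0 ↦ hx ?_
  rw [Function.comp_apply, h0, hc0]

theorem isScalarExtension_Cc (X : Type*) [TopologicalSpace X] :
    IsScalarExtension B (Cc R X) (Cc B X) where
  comp_mem f hf := by
    have h : IsLocallyConstant fun x ↦ algebraMap R B (f x) := hf.1.comp _
    refine ⟨h, hf.2.of_isClosed_subset (isClopen_support h).isClosed fun x hx h0 ↦ hx ?_⟩
    simp [h0]
  sampling S := by
    obtain ⟨J, s, hs⟩ := exists_sampling_Cc (R := R) (f := fun x (f : S) ↦ f.1.1 x)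
      (isLocallyConstant_pi fun f ↦ f.1.2.1) (by
        rw [← Set.image_id (Function.support _)]
        exact isCompact_image_support_pi fun f ↦ by rw [Set.image_id]; exact f.1.2.2)
    exact ⟨J, s, fun f hf x ↦ by simpa using congrFun (hs x) ⟨f, hf⟩⟩
  sampling' f hf := by
    obtain ⟨J, s, hs⟩ := exists_sampling_Cc (R := R) hf.1 hf.2
    exact ⟨J, s, fun x ↦ by simpa [Algebra.smul_def] using hs x⟩

end Cc

/-! ### Compact inductions -/

section Induction

variable {R : Type*} [CommRing R] {G : Type*} [Group G] [TopologicalSpace G]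
  {H : Subgroup G}

theorem comp_mem_cInd {χ : H →* Rˣ} {N : Type*} [Zero N] {f : G → N}
    (hf : IsLocallyConstant f)
    (hcomp : IsCompact (Quotient.mk (QuotientGroup.rightRel H) '' Function.support f))
    {c : N → R} (hc0 : c 0 = 0) (hc : ∀ (n : H) g, c (f (n * g)) = χ n * c (f g)) :
    c ∘ f ∈ cInd H χ := by
  refine ⟨hf.comp _, hc, hcomp.of_isClosed_subset
    (cInd.isClosed_image_support H χ (hf.comp c) hc) (Set.image_mono fun x hx h0 ↦ hx ?_)⟩
  rw [Function.comp_apply, h0, hc0]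

variable [IsDomain R] {χ : H →* Rˣ}

theorem exists_sampling_cInd (hχ : ∀ n, ∃ m : ℕ, IsUnit (m : R) ∧ χ n ^ m = 1)
    {N : Type*} [AddCommGroup N] [Module R N] {f : G → N} (hf : IsLocallyConstant f)
    (hequiv : ∀ (n : H) (g : G), f (n * g) = χ n • f g)
    (hcomp : IsCompact (Quotient.mk (QuotientGroup.rightRel H) '' Function.support f)) :
    ∃ (J : Finset G) (s : G → cInd H χ), ∀ x, f x = ∑ j ∈ J, (s j).1 x • f j := by
  obtain ⟨J, c, hc, hc0, h⟩ := exists_sampling χ.range (N := N)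
    (by
      rintro _ ⟨n, rfl⟩ x hx
      obtain ⟨m, hm, hn⟩ := hχ n
      by_cases h1 : χ n = 1
      · exact Or.inl h1
      · exact Or.inr (eq_zero_of_rootOfUnity_smul_eq hm hn h1 hx))
    (isQuotientMap_quotient_mk' (s := QuotientGroup.rightRel H)) hf
    (by
      intro x y hxy
      have hxy' : x * y⁻¹ ∈ H := QuotientGroup.rightRel_apply.mp (Quotient.exact hxy.symm)
      refine ⟨χ ⟨x * y⁻¹, hxy'⟩, ⟨_, rfl⟩, ?_⟩
      rw [← hequiv]
      simp)
    hcomp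
  exact ⟨J, fun j ↦ ⟨c j ∘ f, comp_mem_cInd hf hcomp (hc0 j) fun n g ↦ by
    rw [hequiv, hc j _ ⟨n, rfl⟩]⟩, h⟩

/-- Both samplings are instances of `exists_sampling_cInd`, with values in `S → R` and in `B`. Only
`R` has to be a domain, since freeness holds on all `R`-modules. -/
theorem isScalarExtension_cInd (B : Type*) [CommRing B] [Algebra R B]
    (hχ : ∀ n, ∃ m : ℕ, IsUnit (m : R) ∧ χ n ^ m = 1) :
    IsScalarExtension B (cInd H χ) (cInd H (extChar B χ)) where
  comp_mem f hf := comp_mem_cInd hf.1 hf.2.2 (map_zero (algebraMap R B)) fun n g ↦ by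
    rw [hf.2.1, map_mul]
    rfl
  sampling S := by
    obtain ⟨J, s, hs⟩ := exists_sampling_cInd hχ (f := fun x (f : S) ↦ f.1.1 x)
      (isLocallyConstant_pi fun f ↦ f.1.2.1) (fun n g ↦ funext fun f ↦ f.1.2.2.1 n g)
      (isCompact_image_support_pi fun f ↦ f.1.2.2.2)
    exact ⟨J, s, fun f hf x ↦ by simpa using congrFun (hs x) ⟨f, hf⟩⟩
  sampling' f hf := by
    obtain ⟨J, s, hs⟩ := exists_sampling_cInd hχ hf.1
      (fun n g ↦ (hf.2.1 n g).trans (Algebra.smul_def _ _).symm) hf.2.2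
    exact ⟨J, s, fun x ↦ by simpa [Algebra.smul_def] using hs x⟩

end Induction

/-! ### Scalar extension of Haar measures -/

section Haar

variable {R : Type*} [CommRing R] (B : Type*) [CommRing B] [Algebra R B]

/-- The linear form on `C_c^∞(Q, B)` extending a linear form on `C_c^∞(Q, R)`. -/
def extHaar {Q : Type*} [TopologicalSpace Q] (μ : Cc R Q →ₗ[R] R) : Cc B Q →ₗ[B] B :=
  (TensorProduct.AlgebraTensorModule.lift
    (LinearMap.toSpanSingleton B (Cc R Q →ₗ[R] B) (Algebra.linearMap R B ∘ₗ μ))) ∘ₗ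
    (isScalarExtension_Cc B Q).equiv.symm.toLinearMap

theorem extHaar_tmul {Q : Type*} [TopologicalSpace Q] (μ : Cc R Q →ₗ[R] R) (b : B)
    (Φ : Cc R Q) :
    extHaar B μ ((isScalarExtension_Cc B Q).equiv (b ⊗ₜ Φ)) = b * algebraMap R B (μ Φ) := by
  simp [extHaar]

/-- The function `x ↦ Φ (q + x)`. -/
def translateCc {Q : Type*} [AddCommGroup Q] [TopologicalSpace Q] [ContinuousAdd Q] (q : Q) :
    Cc R Q →ₗ[R] Cc R Q where
  toFun Φ := ⟨fun x ↦ Φ.1 (q + x), Φ.2.1.comp_continuous (continuous_const_add q), by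
    have : Function.support (fun x ↦ Φ.1 (q + x)) =
        (fun x ↦ -q + x) '' Function.support Φ.1 := by
      rw [Set.image_add_left, neg_neg]
      rfl
    rw [this]
    exact Φ.2.2.image (continuous_const_add _)⟩
  map_add' _ _ := rfl
  map_smul' _ _ := rfl

variable {Q : Type*} [AddCommGroup Q] [TopologicalSpace Q] [ContinuousAdd Q]

theorem translateCc_equiv (q : Q) (t : B ⊗[R] Cc R Q) :
    translateCc q ((isScalarExtension_Cc B Q).equiv t) =
      (isScalarExtension_Cc B Q).equiv ((translateCc q).baseChange B t) := by
  induction t with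
  | zero => simp
  | add s t hs ht => simp only [map_add, hs, ht]
  | tmul b Φ =>
    ext x
    rw [LinearMap.baseChange_tmul, IsScalarExtension.equiv_tmul]
    exact (isScalarExtension_Cc B Q).equiv_tmul b Φ (q + x)

/-- Invariance is checked on pure tensors. The indicator of `K` over `B` comes from the one over
`R`, so the new volumes include the images of the old ones, which generate the unit ideal. -/
theorem IsInvertibleHaar.extHaar {μ : Cc R Q →ₗ[R] R} (hμ : IsInvertibleHaar μ) :
    IsInvertibleHaar (WeilRep.extHaar B μ) where
  invariant q Φ Φ' h := by
    have hΦ' : Φ' = translateCc q Φ := Subtype.ext (funext h)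
    obtain ⟨t, rfl⟩ := (isScalarExtension_Cc (R := R) B Q).equiv.surjective Φ
    rw [hΦ', translateCc_equiv]
    clear h hΦ'
    induction t with
    | zero => simp
    | add s t hs ht => simp only [map_add, hs, ht]
    | tmul b Φ =>
      rw [LinearMap.baseChange_tmul, extHaar_tmul, extHaar_tmul,
        hμ.invariant q Φ (translateCc q Φ) fun _ ↦ rfl]
  invertible := by
    rw [eq_top_iff, ← Ideal.map_top (algebraMap R B), ← hμ.invertible, Ideal.map_span]
    refine Ideal.span_mono ?_
    rintro _ ⟨_, ⟨K, Φ, hK, hK', hΦ, rfl⟩, rfl⟩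
    refine ⟨K, (isScalarExtension_Cc B Q).equiv (1 ⊗ₜ Φ), hK, hK', ?_, ?_⟩
    · ext x
      rw [IsScalarExtension.equiv_tmul, hΦ, one_mul]
      by_cases hx : x ∈ (K : Set Q) <;> simp [hx]
    · rw [extHaar_tmul, one_mul]

end Haar
/-! ### Scalar extension of the metaplectic group -/

section Weil

variable {F : Type*} [Field F] [TopologicalSpace F] {W : Type*} [AddCommGroup W] [Module F W]
  [TopologicalSpace W] {form : LinearMap.BilinForm F W} {R : Type*} [CommRing R]
  {A : AddSubgroup W}

/-- The smooth characters of `A_H` have values in the roots of unity of order a power of `p`. -/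
theorem exists_pow_eq_one {p : ℕ} (hp : Filter.Tendsto (fun k : ℕ ↦ (p : F) ^ k) Filter.atTop (𝓝 0))
    [ContinuousMul F] [ContinuousSMul F W] (halt : form.IsAlt)
    {χ : heisSubgroup form A →* Rˣ} (hχ : IsLocallyConstant χ) (x : heisSubgroup form A) :
    ∃ k : ℕ, χ x ^ p ^ k = 1 := by
  -- The cocycle terms vanish because the form is alternating.
  have hpow : ∀ n : ℕ, x.1 ^ n = ⟨(n : F) • x.1.w, (n : F) * x.1.t⟩ := fun n ↦ by
    induction n with
    | zero => rw [pow_zero]; ext <;> simp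
    | succ n ih =>
      rw [pow_succ, ih]
      ext
      · simp [add_smul]
      · simp [halt x.1.w, add_mul]
  have hcont : Continuous fun c : F ↦ (⟨c • x.1.w, c * x.1.t⟩ : Heis form) :=
    continuous_induced_rng.mpr
      ((continuous_id.smul continuous_const).prodMk (continuous_id.mul continuous_const))
  have htend : Filter.Tendsto (fun k : ℕ ↦ x ^ p ^ k) Filter.atTop (𝓝 1) := by
    rw [tendsto_subtype_rng]
    have h := (hcont.tendsto 0).comp hp
    have h1 : (⟨(0 : F) • x.1.w, 0 * x.1.t⟩ : Heis form) = 1 := by ext <;> simp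
    rw [h1] at h
    refine h.congr fun k ↦ ?_
    rw [SubgroupClass.coe_pow, hpow]
    simp
  obtain ⟨k, hk⟩ := (htend.eventually (hχ.eventually_eq 1)).exists
  exact ⟨k, by rw [← map_pow, hk, map_one]⟩

variable (B : Type*) [CommRing B] [Algebra R B] {χ : heisSubgroup form A →* Rˣ}

/-- The identification `V_A^R ⊗ B ≃ V_A^B`. -/
def modelExt (h : IsScalarExtension B (cInd (heisSubgroup form A) χ)
      (cInd (heisSubgroup form A) (extChar B χ))) :
    B ⊗[R] Model χ ≃ₗ[B] Model (extChar B χ) :=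
  h.equiv

theorem modelExt_tmul (h : IsScalarExtension B (cInd (heisSubgroup form A) χ)
      (cInd (heisSubgroup form A) (extChar B χ))) (b : B) (f : Model χ) (x : Heis form) :
    modelExt B h (b ⊗ₜ f) x = b * algebraMap R B (f x) :=
  h.equiv_tmul b f x

theorem glExt_apply {V V' : Type*} [AddCommGroup V] [Module R V] [AddCommGroup V'] [Module B V']
    (e : B ⊗[R] V ≃ₗ[B] V') (M : V ≃ₗ[R] V) (t : B ⊗[R] V) :
    glExt B e M (e t) = e ((M : V →ₗ[R] V).baseChange B t) := by
  change e ((M : V →ₗ[R] V).baseChange B (e.symm (e t))) = _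
  rw [e.symm_apply_apply]

theorem glExt_mem_scalars {V V' : Type*} [AddCommGroup V] [Module R V] [AddCommGroup V']
    [Module B V'] (e : B ⊗[R] V ≃ₗ[B] V') {M : V ≃ₗ[R] V} (hM : M ∈ scalars R V) :
    glExt B e M ∈ scalars B V' := by
  obtain ⟨r, rfl⟩ := hM
  refine ⟨Units.map (algebraMap R B).toMonoidHom r, ?_⟩
  ext v
  obtain ⟨t, rfl⟩ := e.surjective v
  rw [glExt_apply]
  change algebraMap R B r • e t = _
  rw [← map_smul]
  congr 1
  induction t with
  | zero => simp
  | add s t hs ht => simp only [smul_add, map_add, hs, ht]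
  | tmul b f =>
    rw [LinearMap.baseChange_tmul]
    change _ = b ⊗ₜ[R] ((r : R) • f)
    rw [algebraMap_smul, TensorProduct.tmul_smul]

/-- The same point `z` and the extended measure work. The integral formula is additive in `f`, so it
suffices to treat `b ⊗ f`, whose integrand is the image of `b ⊗ Φ`. -/
theorem isWeilOperator_glExt [IsTopologicalAddGroup W] {e : B ⊗[R] Model χ ≃ₗ[B] Model (extChar B χ)}
    (he : ∀ b f h, e (b ⊗ₜ f) h = b * algebraMap R B (f h)) {ψ : AddChar F R} {g : Sp form}
    {M : Model χ ≃ₗ[R] Model χ} (hM : IsWeilOperator ψ χ g M) :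
    IsWeilOperator (extAddChar B ψ) (extChar B χ) g (glExt B e M) := by
  obtain ⟨μ, z, hμ, hz, hM⟩ := hM
  refine ⟨extHaar B μ, z, hμ.extHaar B, ?_, ?_⟩
  · intro a h₁ h₂
    exact (map_mul (algebraMap R B) _ _).symm.trans (congrArg (algebraMap R B) (hz a h₁ h₂))
  · intro f h
    obtain ⟨t, rfl⟩ := e.surjective f
    rw [glExt_apply]
    induction t with
    | zero =>
      refine ⟨0, fun a ↦ ?_, ?_⟩
      · rw [map_zero]
        exact (mul_zero _).symm
      · rw [map_zero, map_zero, map_zero]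
        rfl
    | add s t hs ht =>
      obtain ⟨Φ, hΦ, hs⟩ := hs
      obtain ⟨Φ', hΦ', ht⟩ := ht
      refine ⟨Φ + Φ', fun a ↦ ?_, ?_⟩
      · rw [map_add]
        refine (congrArg₂ (· + ·) (hΦ a) (hΦ' a)).trans (mul_add _ _ _).symm
      · rw [map_add, map_add, map_add, ← hs, ← ht]
        rfl
    | tmul b f =>
      obtain ⟨Φ, hΦ, hf⟩ := hM f h
      refine ⟨(isScalarExtension_Cc B _).equiv (b ⊗ₜ Φ), fun a ↦ ?_, ?_⟩
      · rw [IsScalarExtension.equiv_tmul, hΦ, map_mul, mul_left_comm]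
        exact congrArg _ (he b f _).symm
      · rw [LinearMap.baseChange_tmul, he, extHaar_tmul, ← hf]
        rfl

/-- `(g, M) ↦ (g, φ_B(M))` sends the metaplectic group over `R` to the one over `B`. -/
theorem map_mem_Mp [IsTopologicalAddGroup W] {e : B ⊗[R] Model χ ≃ₗ[B] Model (extChar B χ)}
    (he : ∀ b f h, e (b ⊗ₜ f) h = b * algebraMap R B (f h)) {ψ : AddChar F R}
    {x : Sp form × (Model χ ≃ₗ[R] Model χ)} (hx : x ∈ Mp ψ χ) :
    (MonoidHom.id _).prodMap (glExt B e) x ∈ Mp (extAddChar B ψ) (extChar B χ) := by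
  have : Mp ψ χ ≤ (Mp (extAddChar B ψ) (extChar B χ)).comap
      ((MonoidHom.id _).prodMap (glExt B e)) := by
    rw [Mp, Subgroup.closure_le]
    rintro ⟨g, M⟩ ⟨N, hN, hNM⟩
    refine Subgroup.subset_closure ⟨glExt B e N, isWeilOperator_glExt B he hN, ?_⟩
    -- `M` differs from the Weil operator `N` by a scalar, which stays a scalar over `B`.
    have h := glExt_mem_scalars B e (QuotientGroup.eq.mp hNM)
    rw [map_mul, map_inv] at h
    exact QuotientGroup.eq.mpr h
  exact this hx

/-- The stabilisers of the vectors of `V_A^R ⊗ B` in the metaplectic group are open. -/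
theorem isOpen_weilRep_baseChange_eq {ψ : AddChar F R} (t s : B ⊗[R] Model χ) :
    IsOpen {x : Mp ψ χ | (weilRep ψ χ x).baseChange B t = s} := by
  obtain ⟨S, rfl⟩ := TensorProduct.exists_finsupp_right t
  rw [isOpen_iff_mem_nhds]
  intro x hx
  have hopen : ∀ f f' : Model χ, IsOpen {y : Mp ψ χ | y.1.2 f = f'} := fun f f' ↦ by
    let := glTopology R (Model χ)
    have h : IsOpen {M : Model χ ≃ₗ[R] Model χ | M f = f'} :=
      TopologicalSpace.isOpen_generateFrom_of_mem ⟨f, f', rfl⟩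
    exact (h.preimage continuous_snd).preimage
      (continuous_induced_dom (f := (Subtype.val : Mp ψ χ → _)))
  -- The tensor involves finitely many `f`, and agreement with `x` on each is an open condition by
  -- the choice of prebasis.
  have hmem : ∀ᶠ y in 𝓝 x, ∀ f ∈ S.support, y.1.2 f = x.1.2 f := by
    rw [Filter.eventually_all_finset]
    exact fun f _ ↦ (hopen f (x.1.2 f)).mem_nhds rfl
  filter_upwards [hmem] with y hy
  rw [← (show (weilRep ψ χ x).baseChange B _ = s from hx), Finsupp.sum, map_sum,
    map_sum]
  refine Finset.sum_congr rfl fun f hf ↦ ?_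
  rw [LinearMap.baseChange_tmul, LinearMap.baseChange_tmul]
  exact congrArg _ (hy f hf)

theorem isRep'_extRep_weilRep {ψ : AddChar F R} (H : Subgroup (Sp form)) :
    IsRep' (extRep B ((weilRep ψ χ).comp (hatGroup ψ χ H).subtype)) where
  smooth v := (isOpen_weilRep_baseChange_eq B v v).preimage continuous_subtype_val
  sign ε x _ _ hx v := by
    change ((weilRep ψ χ x.1).baseChange B) v = _
    have : weilRep ψ χ x.1 = ε • LinearMap.id := LinearMap.ext hx
    rw [this, LinearMap.baseChange_smul, LinearMap.baseChange_id]
    exact (algebraMap_smul B ε v).symm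

/-- Carries smoothness and the sign condition over to the representation on `V_A^B`, so that no
continuity of the morphism of metaplectic groups has to be checked. -/
theorem IsRep'.congr {ψ : AddChar F R} {H : Subgroup (Sp form)} {B : Type*} [CommRing B]
    [Algebra R B] {V V' : Type*} [AddCommGroup V] [Module B V] [AddCommGroup V'] [Module B V']
    {ρ : Representation B (hatGroup ψ χ H) V} {ρ' : Representation B (hatGroup ψ χ H) V'}
    (h : IsRep' ρ) (e : V ≃ₗ[B] V') (he : ∀ x v, e (ρ x v) = ρ' x (e v)) : IsRep' ρ' where
  smooth v := by
    obtain ⟨v, rfl⟩ := e.surjective v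
    simpa only [← he, e.injective.eq_iff] using h.smooth v
  sign ε x hε hx hx' v := by
    obtain ⟨v, rfl⟩ := e.surjective v
    rw [← he, h.sign ε x hε hx hx', map_smul]

end Weil

end WeilRep

end

/-! ### The main theorem -/

open WeilRep in
theorem mainTheorem8
    -- the field `F`, finite or local non-archimedean, of characteristic not `2`
    {F : Type*} [Field F] [TopologicalSpace F] {p : ℕ}
    (hF : IsFiniteOrLocalField F p) (hF2 : (2 : F) ≠ 0)
    -- the cyclotomic field `𝒦`, and `𝒜 = CoeffRing K p`
    {K : Type*} [Field K] [CharZero K] [IsCyclotomicExtension (rootOrders F p) ℚ K]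
    -- the non-trivial smooth character `ψ : F → 𝒜^×`
    (ψ : AddChar F (CoeffRing K p)) (hψ : IsLocallyConstant ψ) (hψ1 : ψ ≠ 1)
    -- the symplectic space `W`, with its usual topology
    {W : Type*} [AddCommGroup W] [Module F W] [FiniteDimensional F W]
    [TopologicalSpace W] [IsModuleTopology F W]
    (form : LinearMap.BilinForm F W) (halt : form.IsAlt) (hnd : form.Nondegenerate)
    -- a self-dual subgroup `A`, and a smooth character `ψ_A` of `A_H` extending `ψ`
    (A : AddSubgroup W) (hA : IsClosed (A : Set W)) (hAdual : psiOrthogonal form ψ A = A)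
    (ψA : heisSubgroup form A →* (CoeffRing K p)ˣ) (hψA : IsLocallyConstant ψA)
    (hext : ∀ x : heisSubgroup form A, x.1.w = 0 → (ψA x : CoeffRing K p) = ψ x.1.t)
    -- an `𝒜`-algebra `B`
    (B : Type*) [CommRing B] [Algebra (CoeffRing K p) B] :
    -- the canonical identification `V_A^𝒜 ⊗ B ≃ V_A^B`, which sends `f ⊗ b` to `b (φ ∘ f)`
    ∃ e : B ⊗[CoeffRing K p] Model ψA ≃ₗ[B] Model (extChar B ψA),
      (∀ b f h, e (b ⊗ₜ f) h = b * algebraMap (CoeffRing K p) B (f h)) ∧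
      -- the morphism `(g, M) ↦ (g, φ_B(M))` between the metaplectic groups over `𝒜` and `B`
      ∃ Φ : Mp ψ ψA →* Mp (extAddChar B ψ) (extChar B ψA),
        (∀ x, (Φ x).1 = (x.1.1, glExt B e x.1.2)) ∧
        -- the two representations of `Ĥ^𝒜`, and the isomorphism given by `e`
        ∀ H : Subgroup (Sp form), IsClosed (H : Set (Sp form)) →
          let ω₁ : Representation B (hatGroup ψ ψA H) (B ⊗[CoeffRing K p] Model ψA) :=
            extRep B ((weilRep ψ ψA).comp (hatGroup ψ ψA H).subtype)
          let ω₂ : Representation B (hatGroup ψ ψA H) (Model (extChar B ψA)) :=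
            (weilRep (extAddChar B ψ) (extChar B ψA)).comp (Φ.comp (hatGroup ψ ψA H).subtype)
          IsRep' ω₁ ∧ IsRep' ω₂ ∧
            ∀ (x : hatGroup ψ ψA H) v, e (ω₁ x v) = ω₂ x (e v) := by
  have := hF.isTopologicalRing
  have : ContinuousSMul F W := IsModuleTopology.toContinuousSMul F W
  have : IsTopologicalAddGroup W := IsModuleTopology.topologicalAddGroup F W
  have hp : ∀ n, ∃ m : ℕ, IsUnit (m : CoeffRing K p) ∧ ψA n ^ m = 1 := fun n ↦ by
    obtain ⟨k, hk⟩ := exists_pow_eq_one hF.tendsto_pow halt hψA n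
    refine ⟨p ^ k, ?_, hk⟩
    rw [Nat.cast_pow]
    exact (CoeffRing.isUnit_natCast K hF.ne_zero).pow k
  let e := modelExt B (isScalarExtension_cInd B hp)
  have he : ∀ b f h, e (b ⊗ₜ f) h = b * algebraMap (CoeffRing K p) B (f h) :=
    modelExt_tmul B (isScalarExtension_cInd B hp)
  refine ⟨e, he, (((MonoidHom.id _).prodMap (glExt B e)).comp (Mp ψ ψA).subtype).codRestrict _
    fun x ↦ map_mem_Mp B he x.2, fun _ ↦ rfl, fun H _ ↦ ?_⟩
  intro ω₁ ω₂
  have hω : ∀ (x : hatGroup ψ ψA H) v, e (ω₁ x v) = ω₂ x (e v) := fun x v ↦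
    (glExt_apply B e x.1.1.2 v).symm
  have h₁ : IsRep' ω₁ := isRep'_extRep_weilRep B H
  exact ⟨h₁, h₁.congr e hω, hω⟩
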